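/- **Theorem 1.1.** Let $\mathbb K$ be a field of characteristic zero, and let $\mathrm{LBA}_\hbar$ be the category of Lie bialgebras $(\mathfrak a,[\,,],\delta_{\mathfrak a})$ over $\mathbb K[[\hbar]]$ whose underlying $\mathbb K[[\hbar]]$-module is topologically free, i.e. isomorphic to $V[[\hbar]]$ for some $\mathbb K$-vector space $V$ (tensor products are $\hbar$-adically completed, so that $V[[\hbar]]\otimes W[[\hbar]]=(V\otimes W)[[\hbar]]$). Consider assignments $\mathfrak a\mapsto f_{\mathfrak a}\in\mathrm{Hom}_{\mathbb K[[\hbar]]}(\mathfrak a^{\otimes n},\mathfrak a^{\otimes m})$ defined for all objects $\mathfrak a$ of $\mathrm{LBA}_\hbar$. The *universal* ones are those given by compositions of tensor products of the bracket and the cobracket, the composition being the same for all $\mathfrak a$; precisely, they form the smallest system of $\hbar$-adically closed $\mathbb K[[\hbar]]$-submodules of the spaces of such assignments that contains the identities, the permutations of tensor factors, the bracket and the cobracket, and that is stable under external tensor products and under composition. Let $\mathcal G_0(\mathbb K)$ be the set of all functorial assignments $\mathfrak a\mapsto\rho_{\mathfrak a}\in\mathrm{End}_{\mathbb K[[\hbar]]}(\mathfrak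 a)$, $\mathfrak a\in\mathrm{LBA}_\hbar$, that are universal and satisfy 1. $\rho_{\mathfrak a}\equiv\mathrm{id}_{\mathfrak a}$ modulo $\hbar$ for every $\mathfrak a$; 2. $\rho_{\mathfrak a^*}=(\rho_{\mathfrak a})^t$ for every $\mathfrak a$ of finite rank, $\mathfrak a^*$ being the dual Lie bialgebra; 3. $[\rho_{\mathfrak a}(x),y]=\rho_{\mathfrak a}([x,y])$ for every $\mathfrak a$ and all $x,y\in\mathfrak a$. Assignments are multiplied by $(\rho\sigma)_{\mathfrak a}=\rho_{\mathfrak a}\circ\sigma_{\mathfrak a}$. Then the multiplicative map $\lambda\mapsto(\mathfrak a\mapsto\lambda\,\mathrm{id}_{\mathfrak a})$, defined on the subgroup $1+\hbar\mathbb K[[\hbar]]$ of $\mathbb K[[\hbar]]^\times$, is injective and its image is exactly $\mathcal G_0(\mathbb K)$. In other words, $\mathcal G_0(\mathbb K)$ is equal to its subgroup $1+\hbar\mathbb K[[\hbar]]$. -/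

import Mathlib

open scoped TensorProduct

universe u

namespace LieBialg

/-- `V[[ħ]]`: formal power series `∑ vₙ ħⁿ` with coefficients `vₙ` in the vector space `V`. The
topologically free `K[[ħ]]`-modules are, up to isomorphism, exactly the modules `V[[ħ]]`. -/
@[ext] structure Ser (V : Type u) : Type u where
  /-- the coefficient of `ħⁿ` -/
  coeff : ℕ → V

namespace Ser

section Group

variable {V : Type u} [AddCommGroup V]

instance : Zero (Ser V) := ⟨⟨fun _ => 0⟩⟩
instance : Add (Ser V) := ⟨fun x y => ⟨fun n => x.coeff n + y.coeff n⟩⟩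
instance : Neg (Ser V) := ⟨fun x => ⟨fun n => -x.coeff n⟩⟩
instance : Sub (Ser V) := ⟨fun x y => ⟨fun n => x.coeff n - y.coeff n⟩⟩
instance : SMul ℕ (Ser V) := ⟨fun k x => ⟨fun n => k • x.coeff n⟩⟩
instance : SMul ℤ (Ser V) := ⟨fun k x => ⟨fun n => k • x.coeff n⟩⟩

instance : AddCommGroup (Ser V) :=
  Function.Injective.addCommGroup (Ser.coeff : Ser V → ℕ → V) (fun _ _ h => Ser.ext h)
    rfl (fun _ _ => rfl) (fun _ => rfl) (fun _ _ => rfl) (fun _ _ => rfl) (fun _ _ => rfl)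

@[simp] theorem coeff_zero (n : ℕ) : (0 : Ser V).coeff n = 0 := rfl

@[simp] theorem coeff_add (x y : Ser V) (n : ℕ) : (x + y).coeff n = x.coeff n + y.coeff n := rfl

/-- The constant series `v + 0 ħ + 0 ħ² + ⋯`. -/
def const (v : V) : Ser V := ⟨fun n => if n = 0 then v else 0⟩

theorem const_add (v w : V) : const (v + w) = const v + const w := by
  ext n
  by_cases h : n = 0 <;> simp [const, h]

end Group

variable {K : Type u} [Field K]
variable {V W V₁ W₁ : Type u} [AddCommGroup V] [Module K V] [AddCommGroup W] [Module K W]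
  [AddCommGroup V₁] [Module K V₁] [AddCommGroup W₁] [Module K W₁]

/-- The scalar multiplication of `K[[ħ]]` on `V[[ħ]]`: the coefficient of `ħⁿ` in `c • x` is
`∑_{i + j = n} cᵢ xⱼ`. -/
noncomputable instance : SMul (PowerSeries K) (Ser V) :=
  ⟨fun c x => ⟨fun n => ∑ p ∈ Finset.HasAntidiagonal.antidiagonal n,
    PowerSeries.coeff p.1 c • x.coeff p.2⟩⟩

theorem coeff_smul (c : PowerSeries K) (x : Ser V) (n : ℕ) :
    (c • x).coeff n = ∑ p ∈ Finset.HasAntidiagonal.antidiagonal n,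
      PowerSeries.coeff p.1 c • x.coeff p.2 := rfl

@[simp] theorem coeff_C_smul (c : K) (x : Ser V) (n : ℕ) :
    (PowerSeries.C c • x).coeff n = c • x.coeff n := by
  rw [coeff_smul, Finset.sum_eq_single (0, n)]
  · simp
  · rintro ⟨i, j⟩ h hne
    have hi : i ≠ 0 := by
      rintro rfl
      simp at h
      exact hne (by simp [h])
    simp [PowerSeries.coeff_C, hi]
  · simp

noncomputable instance : Module (PowerSeries K) (Ser V) where
  one_smul x := by
    ext n
    rw [← map_one PowerSeries.C, coeff_C_smul, one_smul]
  mul_smul c d x := by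
    ext n
    simp only [coeff_smul, PowerSeries.coeff_mul, Finset.sum_smul, Finset.smul_sum, mul_smul]
    rw [Finset.sum_sigma', Finset.sum_sigma']
    refine Finset.sum_nbij' (fun q => ⟨(q.2.1, q.2.2 + q.1.2), (q.2.2, q.1.2)⟩)
      (fun q => ⟨(q.1.1 + q.2.1, q.2.2), (q.1.1, q.2.1)⟩) ?_ ?_ ?_ ?_ ?_ <;>
    · rintro ⟨⟨a, b⟩, ⟨c, d⟩⟩
      simp only [Finset.mem_sigma, Finset.HasAntidiagonal.mem_antidiagonal, and_imp]
      rintro rfl rfl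
      simp [add_assoc]
  smul_zero c := by ext n; simp [coeff_smul]
  smul_add c x y := by ext n; simp [coeff_smul, Finset.sum_add_distrib]
  add_smul c d x := by ext n; simp [coeff_smul, add_smul, Finset.sum_add_distrib]
  zero_smul x := by ext n; simp [coeff_smul]

theorem const_smul (c : K) (v : V) : const (c • v) = PowerSeries.C c • const v := by
  ext n
  by_cases h : n = 0 <;> simp [const, h]

/-- The `K[[ħ]]`-linear map `V[[ħ]] → W[[ħ]]` with `v ↦ ∑ φⱼ(v) ħʲ` for `v ∈ V`, where
`φⱼ : V → W` are `K`-linear maps. Every `K[[ħ]]`-linear map `V[[ħ]] → W[[ħ]]` is of this form. -/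
noncomputable def extend (φ : ℕ → V →ₗ[K] W) : Ser V →ₗ[PowerSeries K] Ser W where
  toFun x := ⟨fun n => ∑ p ∈ Finset.HasAntidiagonal.antidiagonal n, φ p.2 (x.coeff p.1)⟩
  map_add' x y := by ext n; simp [Finset.sum_add_distrib]
  map_smul' c x := by
    ext n
    simp only [coeff_smul, RingHom.id_apply, map_sum, map_smul, Finset.smul_sum]
    rw [Finset.sum_sigma', Finset.sum_sigma']
    refine Finset.sum_nbij' (fun q => ⟨(q.2.1, q.2.2 + q.1.2), (q.2.2, q.1.2)⟩)
      (fun q => ⟨(q.1.1 + q.2.1, q.2.2), (q.1.1, q.2.1)⟩) ?_ ?_ ?_ ?_ ?_ <;>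
    · rintro ⟨⟨a, b⟩, ⟨c, d⟩⟩
      simp only [Finset.mem_sigma, Finset.HasAntidiagonal.mem_antidiagonal, and_imp]
      rintro rfl rfl
      simp [add_assoc]

/-- The coefficients `fⱼ : V → W` of a `K[[ħ]]`-linear map `f : V[[ħ]] → W[[ħ]]`:
`f(v) = ∑ fⱼ(v) ħʲ` for `v ∈ V`. -/
noncomputable def coeffHom (f : Ser V →ₗ[PowerSeries K] Ser W) (j : ℕ) : V →ₗ[K] W where
  toFun v := (f (const v)).coeff j
  map_add' v w := by simp [const_add]
  map_smul' c v := by simp [const_smul]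

/-- Coefficientwise application of a `K`-linear map. -/
noncomputable def map (φ : V →ₗ[K] W) : Ser V →ₗ[PowerSeries K] Ser W where
  toFun x := ⟨fun n => φ (x.coeff n)⟩
  map_add' x y := by ext n; simp
  map_smul' c x := by ext n; simp [coeff_smul]

/-- Coefficientwise application of a `K`-linear isomorphism. -/
noncomputable def congr (e : V ≃ₗ[K] W) : Ser V ≃ₗ[PowerSeries K] Ser W :=
  LinearEquiv.ofLinearMap (map e.toLinearMap) (map e.symm.toLinearMap)
    (by ext x n; simp [map]) (by ext x n; simp [map])

/-- The (completed) tensor product of two `K[[ħ]]`-linear maps, where the completed tensor product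
of `V[[ħ]]` and `W[[ħ]]` over `K[[ħ]]` is `(V ⊗ W)[[ħ]]`: on `V ⊗ W` it is
`∑ₙ ħⁿ ∑_{i + j = n} fᵢ ⊗ gⱼ`. -/
noncomputable def tens (f : Ser V →ₗ[PowerSeries K] Ser V₁) (g : Ser W →ₗ[PowerSeries K] Ser W₁) :
    Ser (V ⊗[K] W) →ₗ[PowerSeries K] Ser (V₁ ⊗[K] W₁) :=
  extend fun n => ∑ p ∈ Finset.HasAntidiagonal.antidiagonal n,
    TensorProduct.map (coeffHom f p.1) (coeffHom g p.2)

/-- The map `f ⊗ id + id ⊗ f` on the (completed) tensor square. -/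
noncomputable def leibniz (f : Ser V →ₗ[PowerSeries K] Ser V) :
    Ser (V ⊗[K] V) →ₗ[PowerSeries K] Ser (V ⊗[K] V) :=
  tens f LinearMap.id + tens LinearMap.id f

end Ser

open Ser

/-- The cyclic permutation `(u ⊗ v) ⊗ w ↦ (w ⊗ u) ⊗ v`. -/
noncomputable def cyc (K : Type u) [Field K] (V : Type u) [AddCommGroup V] [Module K V] :
    (V ⊗[K] V) ⊗[K] V ≃ₗ[K] (V ⊗[K] V) ⊗[K] V :=
  TensorProduct.comm K (V ⊗[K] V) V ≪≫ₗ (TensorProduct.assoc K V V V).symm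

/-- A Lie bialgebra over `K[[ħ]]` whose underlying module is the topologically free module
`V[[ħ]]`. -/
structure LBA (K : Type u) [Field K] where
  /-- the `K`-vector space `V` -/
  V : Type u
  [addCommGroup : AddCommGroup V]
  [module : Module K V]
  /-- the Lie bracket -/
  bracket : Ser V →ₗ[PowerSeries K] Ser V →ₗ[PowerSeries K] Ser V
  /-- the Lie cobracket -/
  cobracket : Ser V →ₗ[PowerSeries K] Ser (V ⊗[K] V)
  bracket_self : ∀ x, bracket x x = 0
  jacobi : ∀ x y z,
    bracket x (bracket y z) + bracket y (bracket z x) + bracket z (bracket x y) = 0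
  cobracket_skew : ∀ x, Ser.congr (TensorProduct.comm K V V) (cobracket x) = -cobracket x
  cojacobi : ∀ x, tens cobracket LinearMap.id (cobracket x)
    + Ser.congr (cyc K V) (tens cobracket LinearMap.id (cobracket x))
    + Ser.congr (cyc K V) (Ser.congr (cyc K V) (tens cobracket LinearMap.id (cobracket x))) = 0
  cocycle : ∀ x y, cobracket (bracket x y) =
    leibniz (bracket x) (cobracket y) - leibniz (bracket y) (cobracket x)

attribute [instance] LBA.addCommGroup LBA.module

/-- Morphisms of Lie bialgebras over `K[[ħ]]`. -/
def IsMorphism {K : Type u} [Field K] (A B : LBA K) (f : Ser A.V →ₗ[PowerSeries K] Ser B.V) : Prop :=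
  (∀ x y, f (A.bracket x y) = B.bracket (f x) (f y)) ∧
  (∀ x, B.cobracket (f x) = tens f f (A.cobracket x))

/-- `B` is the dual Lie bialgebra of `A`, by means of the pairing `p : A × B → K[[ħ]]`: the pairing
is perfect (it identifies `B` with the `K[[ħ]]`-dual of `A`, and `A` with that of `B`, so that both
have finite rank), the bracket of `B` is the transpose of the cobracket of `A`, and the cobracket of
`B` is the transpose of the bracket of `A`. Here `K[[ħ]]` is viewed as the module of series with
coefficients in `K`, and `(K ⊗ K)[[ħ]]` is identified with it. -/
structure IsDual {K : Type u} [Field K] (A B : LBA K)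
    (p : Ser A.V →ₗ[PowerSeries K] Ser B.V →ₗ[PowerSeries K] Ser K) : Prop where
  bijective_left : Function.Bijective p
  bijective_right : Function.Bijective p.flip
  bracket_eq : ∀ x ξ η, p x (B.bracket ξ η) =
    Ser.congr (TensorProduct.lid K K) (tens (p.flip ξ) (p.flip η) (A.cobracket x))
  cobracket_eq : ∀ x y ξ, p (A.bracket x y) ξ =
    Ser.congr (TensorProduct.lid K K) (tens (p x) (p y) (B.cobracket ξ))

/-- Assignments `A ↦ f_A` of a `K[[ħ]]`-linear map from the `n`-th to the `m`-th (completed)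
tensor power of `A`, for every Lie bialgebra `A`. -/
abbrev HomAssignment (K : Type u) [Field K] (n m : ℕ) : Type (u + 1) :=
  ∀ A : LBA K, Ser (⨂[K]^n A.V) →ₗ[PowerSeries K] Ser (⨂[K]^m A.V)

/-- The first tensor power of `V` is `V`. -/
noncomputable def pow1 (K : Type u) [Field K] (V : Type u) [AddCommGroup V] [Module K V] :
    (⨂[K]^1 V) ≃ₗ[K] V :=
  PiTensorProduct.subsingletonEquiv (R := K) (s := fun _ : Fin 1 => V) (0 : Fin 1)

/-- The second tensor power of `V` is `V ⊗ V`. -/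
noncomputable def pow2 (K : Type u) [Field K] (V : Type u) [AddCommGroup V] [Module K V] :
    (⨂[K]^2 V) ≃ₗ[K] V ⊗[K] V :=
  (TensorPower.mulEquiv (R := K) (M := V) (n := 1) (m := 1)).symm ≪≫ₗ
    TensorProduct.congr (pow1 K V) (pow1 K V)

/-- The bracket of `A` as a map `A ⊗ A → A` on the completed tensor square. -/
noncomputable def LBA.bracketHom {K : Type u} [Field K] (A : LBA K) :
    Ser (A.V ⊗[K] A.V) →ₗ[PowerSeries K] Ser A.V :=
  extend fun n => TensorProduct.lift <| LinearMap.mk₂ K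
    (fun v w => (A.bracket (const v) (const w)).coeff n)
    (fun v v' w => by simp [const_add])
    (fun c v w => by simp [const_smul])
    (fun v w w' => by simp [const_add])
    (fun c v w => by simp [const_smul])

/-- The universal maps: those given by compositions of tensor products of the bracket and the
cobracket (and of permutations of the factors), the composition being the same for all Lie
bialgebras. Precisely, they form the smallest `ħ`-adically closed system of `K[[ħ]]`-submodules of
the spaces of assignments that contains the identity, the permutations of tensor factors, the bracket
and the cobracket, and is stable under external tensor products and under composition. -/
inductive IsUniversal {K : Type u} [Field K] : ∀ n m : ℕ, HomAssignment K n m → Prop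
  | perm (n : ℕ) (σ : Equiv.Perm (Fin n)) : IsUniversal n n fun A =>
      (Ser.congr (PiTensorProduct.reindex K (fun _ : Fin n => A.V) σ)).toLinearMap
  | bracket : IsUniversal 2 1 fun A =>
      (Ser.congr (pow1 K A.V)).symm.toLinearMap ∘ₗ A.bracketHom ∘ₗ
        (Ser.congr (pow2 K A.V)).toLinearMap
  | cobracket : IsUniversal 1 2 fun A =>
      (Ser.congr (pow2 K A.V)).symm.toLinearMap ∘ₗ A.cobracket ∘ₗ
        (Ser.congr (pow1 K A.V)).toLinearMap
  | tensor {n m n' m' : ℕ} {f : HomAssignment K n m} {g : HomAssignment K n' m'} :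
      IsUniversal n m f → IsUniversal n' m' g → IsUniversal (n + n') (m + m') fun A =>
        (Ser.congr (TensorPower.mulEquiv (R := K) (M := A.V) (n := m) (m := m'))).toLinearMap ∘ₗ
          tens (f A) (g A) ∘ₗ
          (Ser.congr (TensorPower.mulEquiv (R := K) (M := A.V) (n := n) (m := n'))).symm.toLinearMap
  | comp {n m l : ℕ} {f : HomAssignment K n m} {g : HomAssignment K m l} :
      IsUniversal n m f → IsUniversal m l g → IsUniversal n l fun A => g A ∘ₗ f A
  | add {n m : ℕ} {f g : HomAssignment K n m} :
      IsUniversal n m f → IsUniversal n m g → IsUniversal n m fun A => f A + g A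
  | smul {n m : ℕ} (c : PowerSeries K) {f : HomAssignment K n m} :
      IsUniversal n m f → IsUniversal n m fun A => c • f A
  | limit {n m : ℕ} {f : HomAssignment K n m} (g : ℕ → HomAssignment K n m) :
      (∀ N, IsUniversal n m (g N)) →
      (∀ N A, ∃ h : Ser (⨂[K]^n A.V) →ₗ[PowerSeries K] Ser (⨂[K]^m A.V),
        f A = g N A + (PowerSeries.X : PowerSeries K) ^ N • h) →
      IsUniversal n m f

/-- Assignments `A ↦ ρ_A` of a `K[[ħ]]`-module endomorphism of `A` to every Lie bialgebra `A`; they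
form a monoid for the composition `(ρ σ)_A = ρ_A ∘ σ_A`. -/
abbrev EndAssignment (K : Type u) [Field K] : Type (u + 1) :=
  ∀ A : LBA K, Module.End (PowerSeries K) (Ser A.V)

/-- The conditions that define the set `𝒢₀(K)` of universal automorphisms of the adjoint representations of Lie bialgebras. -/
structure IsG0 {K : Type u} [Field K] (ρ : EndAssignment K) : Prop where
  functorial : ∀ (A B : LBA K) (f : Ser A.V →ₗ[PowerSeries K] Ser B.V),
    IsMorphism A B f → ∀ x, f (ρ A x) = ρ B (f x)
  mod_hbar : ∀ (A : LBA K) (x : Ser A.V),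
    ∃ y : Ser A.V, ρ A x = x + (PowerSeries.X : PowerSeries K) • y
  dual : ∀ (A B : LBA K) (p : Ser A.V →ₗ[PowerSeries K] Ser B.V →ₗ[PowerSeries K] Ser K),
    IsDual A B p → ∀ x ξ, p x (ρ B ξ) = p (ρ A x) ξ
  bracket : ∀ (A : LBA K) (x y : Ser A.V), A.bracket (ρ A x) y = ρ A (A.bracket x y)
  universal : IsUniversal 1 1 fun A =>
    (Ser.congr (pow1 K A.V)).symm.toLinearMap ∘ₗ ρ A ∘ₗ (Ser.congr (pow1 K A.V)).toLinearMap

/-- The set `𝒢₀(K)`, with the composition of `EndAssignment K`. -/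
def G0 (K : Type u) [Field K] : Set (EndAssignment K) := {ρ | IsG0 ρ}

/-- The multiplicative group `1 + ħ K[[ħ]]`, as a subgroup of the group of units of `K[[ħ]]`. -/
def oneAddHbar (K : Type u) [Field K] : Subgroup (PowerSeries K)ˣ where
  carrier := {c | ∃ d : PowerSeries K, (c : PowerSeries K) = 1 + PowerSeries.X * d}
  one_mem' := ⟨0, by simp⟩
  mul_mem' := by
    rintro a b ⟨d, hd⟩ ⟨e, he⟩
    exact ⟨d + e + PowerSeries.X * d * e, by rw [Units.val_mul, hd, he]; ring⟩
  inv_mem' := by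
    rintro a ⟨d, hd⟩
    refine ⟨-(d * (a⁻¹ : (PowerSeries K)ˣ)), ?_⟩
    have h : (a : PowerSeries K) * (a⁻¹ : (PowerSeries K)ˣ) = 1 := a.mul_inv
    rw [hd] at h
    linear_combination h

/-- The map `λ ↦ (A ↦ λ id_A)`, which is multiplicative. -/
noncomputable def scalar (K : Type u) [Field K] : oneAddHbar K →* EndAssignment K where
  toFun c A := ((c : (PowerSeries K)ˣ) : PowerSeries K) • LinearMap.id
  map_one' := by funext A; ext x : 1; simp
  map_mul' c d := by
    funext A
    ext x : 1
    simp only [Subgroup.coe_mul, Units.val_mul, Pi.mul_apply, Module.End.mul_apply,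
      LinearMap.smul_apply, LinearMap.id_apply, mul_smul]

end LieBialg

/-! On the rank-one Lie bialgebra with zero operations, `ρ` is multiplication by a scalar `c`, and
`c` lies in `1 + ħK[[ħ]]` by the condition modulo `ħ`. The point is that `c` governs every `A`
(`IsG0.eq_smul`). Cover `A` by a Lie bialgebra `F` (`exists_cover`): the free Lie algebra on a basis
of `A.V` and one extra generator `d`, extended to series in `ħ`. Cocycles on a free Lie algebra are
determined by arbitrary values on generators, so the cobracket of `A` extends to `F` with `δ(d) =
0`, and `π : F → A`, identity on the basis and zero on `d`, is a morphism. Since `δ(d) = 0`, also `1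
↦ d` is a morphism from the rank-one bialgebra, and functoriality gives `ρ(d) = c d`. Then `[d,
ρ(z)] = ρ([d, z]) = [ρ(d), z] = c [d, z]`, so `ρ(z) - c z` centralizes `d`. This centralizer dies
under `π` (`FreeLie.lift_eq_zero_of_lie_eq_zero`). Hence `π(ρ(z)) = c π(z)`, and functoriality along
`π` yields `ρ = c` on constants, which determine a `K[[ħ]]`-linear map. -/

namespace LieBialg

/-! ### Calculus of `K[[ħ]]`-linear maps and completed tensor products -/

namespace Ser

variable {K : Type u} [Field K]
variable {U V W V₁ W₁ V₂ W₂ Z : Type u} [AddCommGroup U] [Module K U]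
  [AddCommGroup V] [Module K V] [AddCommGroup W] [Module K W]
  [AddCommGroup V₁] [Module K V₁] [AddCommGroup W₁] [Module K W₁]
  [AddCommGroup V₂] [Module K V₂] [AddCommGroup W₂] [Module K W₂] [AddCommGroup Z] [Module K Z]

@[simp] theorem coeff_neg (x : Ser V) (n : ℕ) : (-x).coeff n = -x.coeff n := rfl

@[simp] theorem coeff_sub (x y : Ser V) (n : ℕ) : (x - y).coeff n = x.coeff n - y.coeff n := rfl

theorem const_coeff (v : V) (n : ℕ) : (const v).coeff n = if n = 0 then v else 0 := rfl

@[simp] theorem const_zero : const (0 : V) = 0 := by ext n; simp [const_coeff]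

theorem extend_coeff (φ : ℕ → V →ₗ[K] W) (x : Ser V) (n : ℕ) :
    (extend φ x).coeff n = ∑ p ∈ Finset.HasAntidiagonal.antidiagonal n, φ p.2 (x.coeff p.1) := rfl

theorem sum_antidiagonal_const {M : Type*} [AddCommMonoid M] (v : V) (n : ℕ) (g : ℕ → V → M)
    (hg : ∀ j, g j 0 = 0) :
    ∑ p ∈ Finset.HasAntidiagonal.antidiagonal n, g p.2 ((const v).coeff p.1) = g n v := by
  rw [Finset.sum_eq_single (0, n)]
  · rfl
  · rintro ⟨i, j⟩ h hne
    have hi : i ≠ 0 := by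
      rintro rfl
      simp at h
      exact hne (by simp [h])
    simp [const_coeff, hi, hg]
  · simp

theorem sum_antidiagonal_const' {M : Type*} [AddCommMonoid M] (v : V) (n : ℕ) (g : ℕ → V → M)
    (hg : ∀ j, g j 0 = 0) :
    ∑ p ∈ Finset.HasAntidiagonal.antidiagonal n, g p.1 ((const v).coeff p.2) = g n v := by
  rw [← sum_antidiagonal_const v n g hg, ← Finset.Nat.sum_antidiagonal_swap]
  rfl

@[simp] theorem extend_const (φ : ℕ → V →ₗ[K] W) (v : V) (n : ℕ) :
    (extend φ (const v)).coeff n = φ n v :=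
  sum_antidiagonal_const v n (fun j => φ j) (by simp)

theorem coeffHom_apply (f : Ser V →ₗ[PowerSeries K] Ser W) (j : ℕ) (v : V) :
    coeffHom f j v = (f (const v)).coeff j := rfl

@[simp] theorem coeffHom_extend (φ : ℕ → V →ₗ[K] W) (j : ℕ) : coeffHom (extend φ) j = φ j := by
  ext v; simp [coeffHom_apply]

@[simp] theorem map_coeff (φ : V →ₗ[K] W) (x : Ser V) (n : ℕ) :
    (map φ x).coeff n = φ (x.coeff n) := rfl

@[simp] theorem congr_coeff (e : V ≃ₗ[K] W) (x : Ser V) (n : ℕ) :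
    (congr e x).coeff n = e (x.coeff n) := rfl

theorem coeff_X_pow_smul (k n : ℕ) (x : Ser V) :
    ((PowerSeries.X : PowerSeries K) ^ k • x).coeff n = if k ≤ n then x.coeff (n - k) else 0 := by
  rw [coeff_smul]
  split_ifs with h
  · rw [Finset.sum_eq_single (k, n - k)]
    · simp
    · rintro ⟨i, j⟩ hij hne
      have hi : i ≠ k := by
        rintro rfl
        simp at hij
        exact hne (by simp [← hij])
      simp [PowerSeries.coeff_X_pow, hi]
    · intro h'; simp [h] at h'
  · refine Finset.sum_eq_zero ?_
    rintro ⟨i, j⟩ hij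
    have hi : i ≠ k := by
      rintro rfl
      simp at hij
      omega
    simp [PowerSeries.coeff_X_pow, hi]

theorem coeff_X_smul_succ (n : ℕ) (x : Ser V) :
    ((PowerSeries.X : PowerSeries K) • x).coeff (n + 1) = x.coeff n := by
  simpa using coeff_X_pow_smul (K := K) 1 (n + 1) x

theorem coeff_X_smul_zero (x : Ser V) : ((PowerSeries.X : PowerSeries K) • x).coeff 0 = 0 := by
  simpa using coeff_X_pow_smul (K := K) 1 0 x

theorem eq_const_add_X_smul (K : Type u) [Field K] [Module K V] (x : Ser V) :
    x = const (x.coeff 0) + (PowerSeries.X : PowerSeries K) • (⟨fun n => x.coeff (n + 1)⟩ : Ser V) := by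
  ext n
  rcases n with _ | n
  · rw [coeff_add, coeff_X_smul_zero]; simp [const_coeff]
  · rw [coeff_add, coeff_X_smul_succ]; simp [const_coeff]

/-- Continuity is automatic: writing `x = x₀ + ħ x'`, linearity reduces the coefficient of `ħⁿ⁺¹` at
`x` to that of `ħⁿ` at `x'`. Identities of series can thus be checked on constants. -/
theorem linearMap_ext {f g : Ser V →ₗ[PowerSeries K] Ser W} (h : ∀ v, f (const v) = g (const v)) :
    f = g := by
  have key : ∀ n x, (f x).coeff n = (g x).coeff n := by
    intro n
    induction n with
    | zero =>
      intro x
      rw [eq_const_add_X_smul K x, map_add, map_add, map_smul, map_smul, coeff_add, coeff_add,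
        coeff_X_smul_zero, coeff_X_smul_zero, h]
    | succ n ih =>
      intro x
      rw [eq_const_add_X_smul K x, map_add, map_add, map_smul, map_smul, coeff_add, coeff_add,
        coeff_X_smul_succ, coeff_X_smul_succ, h, ih]
  ext x n
  exact key n x

/-- The `K[[ħ]]`-bilinear extension of a `K`-bilinear map. -/
noncomputable def bilin (β : U →ₗ[K] V →ₗ[K] W) :
    Ser U →ₗ[PowerSeries K] Ser V →ₗ[PowerSeries K] Ser W :=
  LinearMap.mk₂ (PowerSeries K) (fun x y => extend (fun n => β.flip (y.coeff n)) x)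
    (fun x x' y => map_add _ x x') (fun c x y => map_smul _ c x)
    (fun x y y' => by ext n; simp [extend_coeff, Finset.sum_add_distrib])
    (fun c x y => by
      -- Linearity in `x` is built into `extend`; exchanging the two indices displays the same
      -- series as an `extend` in `y`.
      have h : ∀ y : Ser V, extend (fun n => β.flip (y.coeff n)) x
          = extend (fun n => β (x.coeff n)) y := by
        intro y
        ext n
        simp only [extend_coeff, LinearMap.flip_apply]
        rw [← Finset.Nat.sum_antidiagonal_swap]
        rfl
      rw [h, h, map_smul])

theorem bilin_coeff (β : U →ₗ[K] V →ₗ[K] W) (x : Ser U) (y : Ser V) (n : ℕ) :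
    (bilin β x y).coeff n =
      ∑ p ∈ Finset.HasAntidiagonal.antidiagonal n, β (x.coeff p.1) (y.coeff p.2) := rfl

@[simp] theorem bilin_const_left (β : U →ₗ[K] V →ₗ[K] W) (u : U) (y : Ser V) (n : ℕ) :
    (bilin β (const u) y).coeff n = β u (y.coeff n) := by
  rw [bilin_coeff]
  exact sum_antidiagonal_const u n (fun j u => β u (y.coeff j)) (by simp)

@[simp] theorem bilin_const_right (β : U →ₗ[K] V →ₗ[K] W) (x : Ser U) (v : V) (n : ℕ) :
    (bilin β x (const v)).coeff n = β (x.coeff n) v := by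
  rw [bilin_coeff]
  exact sum_antidiagonal_const' v n (fun j v => β (x.coeff j) v) (by simp)

theorem bilin_ext {f g : Ser U →ₗ[PowerSeries K] Ser V →ₗ[PowerSeries K] Ser W}
    (h : ∀ u v, f (const u) (const v) = g (const u) (const v)) : f = g := by
  ext x y : 2
  have h₁ : ∀ u, f (const u) = g (const u) := fun u => linearMap_ext (h u)
  have h₂ : f.flip y = g.flip y := linearMap_ext fun u => by simp [h₁]
  exact LinearMap.congr_fun h₂ x

/-- The tensor product of two elements, in the completed tensor product. -/
noncomputable def tmul : Ser V →ₗ[PowerSeries K] Ser W →ₗ[PowerSeries K] Ser (V ⊗[K] W) :=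
  bilin (TensorProduct.mk K V W)

theorem const_tmul (v : V) (w : W) : const (v ⊗ₜ[K] w) = tmul (K := K) (const v) (const w) := by
  ext n
  rw [tmul, bilin_const_left]
  by_cases h : n = 0 <;> simp [const_coeff, h]

theorem tens_const (f : Ser V →ₗ[PowerSeries K] Ser V₁) (g : Ser W →ₗ[PowerSeries K] Ser W₁)
    (w : V ⊗[K] W) (n : ℕ) : (tens f g (const w)).coeff n =
      ∑ p ∈ Finset.HasAntidiagonal.antidiagonal n,
        TensorProduct.map (coeffHom f p.1) (coeffHom g p.2) w := by
  simp [tens]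

theorem tens_tmul (f : Ser V →ₗ[PowerSeries K] Ser V₁) (g : Ser W →ₗ[PowerSeries K] Ser W₁)
    (x : Ser V) (y : Ser W) : tens f g (tmul (K := K) x y) = tmul (K := K) (f x) (g y) := by
  have h : (tmul (K := K)).compr₂ (tens f g) = (tmul (K := K)).compl₁₂ f g := by
    refine bilin_ext fun v w => ?_
    ext n
    simp only [LinearMap.compr₂_apply, LinearMap.compl₁₂_apply, ← const_tmul, tens_const]
    simp [tmul, bilin_coeff, coeffHom_apply]
  exact LinearMap.congr_fun₂ h x y

theorem linearMap_ext_tmul {f g : Ser (V ⊗[K] W) →ₗ[PowerSeries K] Ser Z}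
    (h : ∀ x y, f (tmul (K := K) x y) = g (tmul (K := K) x y)) : f = g := by
  refine linearMap_ext fun w => ?_
  induction w using TensorProduct.induction_on with
  | zero => simp
  | tmul v w => rw [const_tmul, h]
  | add a b ha hb => simp [const_add, ha, hb]

theorem tens_comp (f : Ser V →ₗ[PowerSeries K] Ser V₁) (g : Ser W →ₗ[PowerSeries K] Ser W₁)
    (f' : Ser V₁ →ₗ[PowerSeries K] Ser V₂) (g' : Ser W₁ →ₗ[PowerSeries K] Ser W₂) :
    tens (f' ∘ₗ f) (g' ∘ₗ g) = tens f' g' ∘ₗ tens f g :=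
  linearMap_ext_tmul fun x y => by simp [tens_tmul]

@[simp] theorem map_const (φ : V →ₗ[K] W) (v : V) : map φ (const v) = const (φ v) := by
  ext n
  by_cases h : n = 0 <;> simp [const_coeff, h]

theorem tens_map (f : V →ₗ[K] V₁) (g : W →ₗ[K] W₁) :
    tens (map f) (map g) = map (TensorProduct.map f g) := by
  refine linearMap_ext fun w => ?_
  induction w using TensorProduct.induction_on with
  | zero => simp
  | tmul v w => rw [const_tmul, tens_tmul, map_const, map_const, ← const_tmul, ← const_tmul,
      map_const, TensorProduct.map_tmul]
  | add a b ha hb => simp only [const_add, map_add, ha, hb]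

theorem tens_id : tens (LinearMap.id : Ser V →ₗ[PowerSeries K] Ser V)
    (LinearMap.id : Ser W →ₗ[PowerSeries K] Ser W) = LinearMap.id :=
  linearMap_ext_tmul fun x y => by simp [tens_tmul]

theorem coeffHom_id (n : ℕ) :
    coeffHom (LinearMap.id : Ser V →ₗ[PowerSeries K] Ser V) n
      = if n = 0 then LinearMap.id else 0 := by
  ext v
  by_cases h : n = 0 <;> simp [coeffHom_apply, const_coeff, h]

theorem tens_id_right (f : Ser V →ₗ[PowerSeries K] Ser V₁) :
    tens f (LinearMap.id : Ser W →ₗ[PowerSeries K] Ser W) =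
      extend fun n => TensorProduct.map (coeffHom f n) LinearMap.id := by
  refine linearMap_ext fun w => ?_
  ext n
  rw [tens_const, extend_const, Finset.sum_eq_single (n, 0)]
  · simp [coeffHom_id]
  · rintro ⟨i, j⟩ h hne
    have hj : j ≠ 0 := by
      rintro rfl
      simp at h
      exact hne (by simp [h])
    simp [coeffHom_id, hj]
  · simp

theorem leibniz_tmul (f : Ser V →ₗ[PowerSeries K] Ser V) (x y : Ser V) :
    leibniz f (tmul (K := K) x y) = tmul (K := K) (f x) y + tmul (K := K) x (f y) := by
  simp [leibniz, tens_tmul]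

theorem tens_leibniz {f : Ser V →ₗ[PowerSeries K] Ser W} {a : Ser V →ₗ[PowerSeries K] Ser V}
    {b : Ser W →ₗ[PowerSeries K] Ser W} (h : f ∘ₗ a = b ∘ₗ f) (w : Ser (V ⊗[K] V)) :
    tens f f (leibniz a w) = leibniz b (tens f f w) := by
  have h' : tens f f ∘ₗ leibniz a = leibniz b ∘ₗ tens f f := by
    have h₁ : ∀ x, f (a x) = b (f x) := LinearMap.congr_fun h
    refine linearMap_ext_tmul fun x y => ?_
    simp [leibniz_tmul, tens_tmul, h₁]
  exact LinearMap.congr_fun h' w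

end Ser

/-! ### Cocycles on free Lie algebras and the centralizer of a generator -/

namespace FreeLie

attribute [local instance] LieRing.ofAssociativeRing

variable {K : Type u} [Field K] {X : Type u}

/-- Lifting the generators into `S` and then including is the identity, by uniqueness in the
universal property. -/
theorem lieSubalgebra_eq_top (S : LieSubalgebra K (FreeLieAlgebra K X))
    (h : ∀ x, FreeLieAlgebra.of K x ∈ S) : S = ⊤ := by
  have hid : S.incl.comp (FreeLieAlgebra.lift K fun x => (⟨FreeLieAlgebra.of K x, h x⟩ : S))
      = LieHom.id := by
    ext x
    simp
  rw [eq_top_iff]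
  intro v _
  have := LieHom.congr_fun hid v
  rw [LieHom.comp_apply, LieHom.id_apply] at this
  rw [← this]
  exact Subtype.property _

section Cocycle

variable {L : Type u} [LieRing L] [LieAlgebra K L] {M : Type u} [AddCommGroup M] [Module K M]

/-- The extension of a Lie algebra `L` by a representation `M`, with `M` an abelian ideal. -/
@[ext] structure AbelianExt (φ : L →ₗ⁅K⁆ Module.End K M) : Type u where
  /-- the component in `L` -/
  fst : L
  /-- the component in `M` -/
  snd : M

namespace AbelianExt

variable (φ : L →ₗ⁅K⁆ Module.End K M)

/-- The underlying module of the extension is the product. -/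
def equivProd : AbelianExt φ ≃ L × M where
  toFun a := (a.fst, a.snd)
  invFun a := ⟨a.1, a.2⟩

instance : AddCommGroup (AbelianExt φ) := (equivProd φ).addCommGroup
instance : Module K (AbelianExt φ) := (equivProd φ).module K

instance : Bracket (AbelianExt φ) (AbelianExt φ) :=
  ⟨fun a b => ⟨⁅a.fst, b.fst⁆, φ a.fst b.snd - φ b.fst a.snd⟩⟩

variable {φ} (a b : AbelianExt φ) (c : K)

@[simp] theorem fst_lie : ⁅a, b⁆.fst = ⁅a.fst, b.fst⁆ := rfl
@[simp] theorem snd_lie : ⁅a, b⁆.snd = φ a.fst b.snd - φ b.fst a.snd := rfl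
@[simp] theorem fst_add : (a + b).fst = a.fst + b.fst := rfl
@[simp] theorem snd_add : (a + b).snd = a.snd + b.snd := rfl
@[simp] theorem fst_zero : (0 : AbelianExt φ).fst = 0 := rfl
@[simp] theorem snd_zero : (0 : AbelianExt φ).snd = 0 := rfl
@[simp] theorem fst_smul : (c • a).fst = c • a.fst := rfl
@[simp] theorem snd_smul : (c • a).snd = c • a.snd := rfl

instance : LieRing (AbelianExt φ) where
  add_lie a b c := by
    ext <;> simp
    abel
  lie_add a b c := by
    ext <;> simp
    abel
  lie_self a := by ext <;> simp
  leibniz_lie a b c := by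
    ext <;> simp [LieRing.of_associative_ring_bracket]
    abel

instance : LieAlgebra K (AbelianExt φ) where
  lie_smul t a b := by ext <;> simp [smul_sub]

variable (φ) in
/-- The projection to `L`. -/
def proj : AbelianExt φ →ₗ⁅K⁆ L where
  toFun a := a.fst
  map_add' _ _ := rfl
  map_smul' _ _ := rfl
  map_lie' := rfl

end AbelianExt

/-- `1`-cocycles on a free Lie algebra may be prescribed on the generators. -/
theorem exists_cocycle (φ : FreeLieAlgebra K X →ₗ⁅K⁆ Module.End K M) (f : X → M) :
    ∃ D : FreeLieAlgebra K X →ₗ[K] M,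
      (∀ u v, D ⁅u, v⁆ = φ u (D v) - φ v (D u)) ∧ ∀ x, D (FreeLieAlgebra.of K x) = f x := by
  -- A cocycle `D` is the same as a section `u ↦ (u, D u)` of the extension; freeness provides the
  -- section.
  let s : FreeLieAlgebra K X →ₗ⁅K⁆ AbelianExt φ :=
    FreeLieAlgebra.lift K fun x => ⟨FreeLieAlgebra.of K x, f x⟩
  have hof : ∀ x, s (FreeLieAlgebra.of K x) = ⟨FreeLieAlgebra.of K x, f x⟩ := fun x =>
    FreeLieAlgebra.lift_of_apply _ x
  have h1 : (AbelianExt.proj φ).comp s = LieHom.id := by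
    ext x
    rw [LieHom.comp_apply, hof]
    rfl
  have h1' : ∀ u, (s u).fst = u := LieHom.congr_fun h1
  exact ⟨⟨⟨fun u => (s u).snd, fun u v => by simp⟩, fun c u => by simp⟩,
    fun u v => by simp [h1'], fun x => by simp [hof]⟩

/-- The kernel of a cocycle is a Lie subalgebra. -/
theorem cocycle_eq_zero (φ : FreeLieAlgebra K X →ₗ⁅K⁆ Module.End K M)
    {D : FreeLieAlgebra K X →ₗ[K] M} (hD : ∀ u v, D ⁅u, v⁆ = φ u (D v) - φ v (D u))
    (h : ∀ x, D (FreeLieAlgebra.of K x) = 0) (u : FreeLieAlgebra K X) : D u = 0 := by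
  let S : LieSubalgebra K (FreeLieAlgebra K X) :=
    { LinearMap.ker D with
      lie_mem' := fun {u v} hu hv => by
        change D u = 0 at hu
        change D v = 0 at hv
        change D _ = 0
        rw [hD, hu, hv, map_zero, map_zero, sub_zero] }
  have : u ∈ S := by rw [lieSubalgebra_eq_top S h]; trivial
  exact this

end Cocycle

/-- A free Lie algebra in characteristic zero has an injective derivation, the degree. -/
theorem exists_injective_derivation (K : Type u) [Field K] [CharZero K] (X : Type u) :
    ∃ E : FreeLieAlgebra K X →ₗ[K] FreeLieAlgebra K X,
      (∀ u v, E ⁅u, v⁆ = ⁅u, E v⁆ - ⁅v, E u⁆) ∧ ∀ u, E u = 0 → u = 0 := by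
  -- The Euler derivation, with `E x = x` on generators; it multiplies a bracket of `n` generators
  -- by `n`.
  obtain ⟨E, hE, hof⟩ := exists_cocycle (LieAlgebra.ad K (FreeLieAlgebra K X))
    (FreeLieAlgebra.of K)
  simp only [LieAlgebra.ad_apply] at hE
  refine ⟨E, hE, ?_⟩
  -- Eigenvalues add under the bracket, so this sum is a subalgebra containing the generators. The
  -- shift `n + 1` keeps the eigenvalue zero out.
  let P : Submodule K (FreeLieAlgebra K X) := ⨆ n : ℕ, Module.End.eigenspace E ((n + 1 : ℕ) : K)
  have hP : ∀ u v, u ∈ P → v ∈ P → ⁅u, v⁆ ∈ P := by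
    intro u v hu hv
    induction hu using Submodule.iSup_induction' with
    | zero => simp
    | add a b _ _ ha hb => rw [add_lie]; exact P.add_mem ha hb
    | mem i a ha =>
      induction hv using Submodule.iSup_induction' with
      | zero => simp
      | add b c _ _ hb hc => rw [lie_add]; exact P.add_mem hb hc
      | mem j b hb =>
        refine Submodule.mem_iSup_of_mem (i + j + 1) ?_
        rw [Module.End.mem_eigenspace_iff] at ha hb ⊢
        rw [hE, ha, hb, lie_smul, lie_smul, ← lie_skew b a, smul_neg, sub_neg_eq_add, ← add_smul]
        congr 1
        push_cast
        ring
  let S : LieSubalgebra K (FreeLieAlgebra K X) := { P with lie_mem' := fun {u v} => hP u v }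
  have hS : ∀ u, u ∈ P := fun u => by
    have : u ∈ S := by
      rw [lieSubalgebra_eq_top S fun x => ?_]
      · trivial
      · refine Submodule.mem_iSup_of_mem 0 ?_
        rw [Module.End.mem_eigenspace_iff, hof]
        simp
    exact this
  intro u hu
  -- In characteristic zero no `n + 1` vanishes, so the kernel, being the eigenspace for `0`, is
  -- independent of the rest.
  have hle : P ≤ ⨆ μ ≠ (0 : K), Module.End.eigenspace E μ :=
    iSup_le fun n => le_iSup₂_of_le ((n + 1 : ℕ) : K) (Nat.cast_ne_zero.2 n.succ_ne_zero) le_rfl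
  have hdisj := Module.End.eigenspaces_iSupIndep E (0 : K)
  refine Submodule.disjoint_def.1 hdisj u ?_ (hle (hS u))
  rw [Module.End.mem_eigenspace_iff, hu, zero_smul]

/-- In a free Lie algebra in characteristic zero, any element that commutes with one of the
generators is killed by each homomorphism that kills this generator. -/
theorem lift_eq_zero_of_lie_eq_zero [CharZero K] {L : Type u} [LieRing L] [LieAlgebra K L]
    (g : X → L) (z : FreeLieAlgebra K (Option X))
    (hz : ⁅FreeLieAlgebra.of K (none : Option X), z⁆ = 0) :
    FreeLieAlgebra.lift K (fun o : Option X => o.elim 0 g) z = 0 := by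
  obtain ⟨E, hE, hinj⟩ := exists_injective_derivation K X
  let θ : FreeLieAlgebra K (Option X) →ₗ⁅K⁆ FreeLieAlgebra K X :=
    FreeLieAlgebra.lift K fun o : Option X => o.elim 0 (FreeLieAlgebra.of K)
  -- The extension of the trivial representation by the adjoint one with class `E`: `u · (w, t) =
  -- ([u, w] - t E u, 0)`. The derivation property of `E` makes it a representation.
  let φ : FreeLieAlgebra K X →ₗ⁅K⁆ Module.End K (FreeLieAlgebra K X × K) :=
    { toFun := fun u =>
        { toFun := fun a => (⁅u, a.1⁆ - a.2 • E u, 0)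
          map_add' := fun a b => by ext <;> simp [add_smul]; abel
          map_smul' := fun c a => by ext <;> simp [smul_sub, mul_smul] }
      map_add' := fun u v => by
        refine LinearMap.ext fun a => ?_
        ext <;> simp
        abel
      map_smul' := fun c u => by
        refine LinearMap.ext fun a => ?_
        ext <;> simp [smul_sub, smul_comm a.2 c]
      map_lie' := fun {u v} => by
        refine LinearMap.ext fun a => ?_
        ext <;> simp [LieRing.of_associative_ring_bracket, hE, smul_sub]
        abel }
  obtain ⟨D, hD, hDof⟩ := exists_cocycle (φ.comp θ)
    (fun o : Option X => o.elim ((0, 1) : FreeLieAlgebra K X × K) fun _ => 0)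
  have hθ : θ (FreeLieAlgebra.of K none) = 0 := FreeLieAlgebra.lift_of_apply _ _
  -- Since `θ` kills the generator and `D` sends it to `(0, 1)`, the cocycle identity for the zero
  -- bracket reads `0 = (E (θ z), 0)`.
  have h := hD (FreeLieAlgebra.of K none) z
  rw [hz, map_zero, LieHom.comp_apply, LieHom.comp_apply, hθ, hDof, map_zero] at h
  have hEz : E (θ z) = 0 := by
    have := congrArg Prod.fst h
    simpa [φ] using this.symm
  have hcomp : FreeLieAlgebra.lift K (fun o : Option X => o.elim 0 g)
      = (FreeLieAlgebra.lift K g).comp θ := by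
    ext o
    rcases o with _ | x <;> simp [θ]
  rw [hcomp, LieHom.comp_apply, hinj _ hEz, map_zero]

end FreeLie

open Ser

attribute [local instance] LieRing.ofAssociativeRing

/-! ### The co-Jacobiator of a skew cocycle is a cocycle -/

section CoJacobi

variable {K : Type u} [Field K] {V W : Type u} [AddCommGroup V] [Module K V]
  [AddCommGroup W] [Module K W]

@[simp] theorem cyc_tmul (u v w : V) :
    cyc K V ((u ⊗ₜ[K] v) ⊗ₜ[K] w) = (w ⊗ₜ[K] u) ⊗ₜ[K] v := rfl

/-- The sum of the cyclic permutations of a tensor of degree three. -/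
noncomputable def cycSum (K : Type u) [Field K] (V : Type u) [AddCommGroup V] [Module K V] :
    (V ⊗[K] V) ⊗[K] V →ₗ[K] (V ⊗[K] V) ⊗[K] V :=
  LinearMap.id + (cyc K V).toLinearMap + (cyc K V).toLinearMap ∘ₗ (cyc K V).toLinearMap

theorem cycSum_apply (x : (V ⊗[K] V) ⊗[K] V) :
    cycSum K V x = x + cyc K V x + cyc K V (cyc K V x) := rfl

theorem cycSum_map (f : V →ₗ[K] W) (x : (V ⊗[K] V) ⊗[K] V) :
    cycSum K W (TensorProduct.map (TensorProduct.map f f) f x) =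
      TensorProduct.map (TensorProduct.map f f) f (cycSum K V x) := by
  have h : cycSum K W ∘ₗ TensorProduct.map (TensorProduct.map f f) f =
      TensorProduct.map (TensorProduct.map f f) f ∘ₗ cycSum K V := by
    apply TensorProduct.ext_threefold
    intro a b c
    simp [cycSum_apply]
  exact LinearMap.congr_fun h x

/-- The co-Jacobiator of the power series `∑ δₙ ħⁿ`. -/
noncomputable def coJacobiator (δ : ℕ → V →ₗ[K] V ⊗[K] V) (n : ℕ) :
    V →ₗ[K] (V ⊗[K] V) ⊗[K] V :=
  ∑ p ∈ Finset.HasAntidiagonal.antidiagonal n,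
    cycSum K V ∘ₗ TensorProduct.map (δ p.2) LinearMap.id ∘ₗ δ p.1

theorem coJacobiator_apply (δ : ℕ → V →ₗ[K] V ⊗[K] V) (n : ℕ) (v : V) :
    coJacobiator δ n v = ∑ p ∈ Finset.HasAntidiagonal.antidiagonal n,
      cycSum K V (TensorProduct.map (δ p.2) LinearMap.id (δ p.1 v)) := by
  simp [coJacobiator]

theorem tens_id_coeff (δ : Ser V →ₗ[PowerSeries K] Ser (V ⊗[K] V)) (v : V) (n : ℕ) :
    (tens δ (LinearMap.id : Ser V →ₗ[PowerSeries K] Ser V) (δ (const v))).coeff n =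
      ∑ p ∈ Finset.HasAntidiagonal.antidiagonal n,
        TensorProduct.map (coeffHom δ p.2) LinearMap.id (coeffHom δ p.1 v) := by
  simp [tens_id_right, extend_coeff, coeffHom_apply]

theorem cojacobi_const (δ : Ser V →ₗ[PowerSeries K] Ser (V ⊗[K] V)) (v : V) (n : ℕ) :
    (tens δ LinearMap.id (δ (const v))
      + Ser.congr (cyc K V) (tens δ LinearMap.id (δ (const v)))
      + Ser.congr (cyc K V) (Ser.congr (cyc K V) (tens δ LinearMap.id (δ (const v))))).coeff n
    = coJacobiator (coeffHom δ) n v := by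
  rw [coeff_add, coeff_add, congr_coeff, congr_coeff, congr_coeff, tens_id_coeff,
    coJacobiator_apply, ← cycSum_apply, map_sum]

variable {L : Type u} [LieRing L] [LieAlgebra K L]

theorem cycSum_lie (u : L) (x : (L ⊗[K] L) ⊗[K] L) : cycSum K L ⁅u, x⁆ = ⁅u, cycSum K L x⁆ := by
  have h : cycSum K L ∘ₗ LieModule.toEnd K L ((L ⊗[K] L) ⊗[K] L) u =
      LieModule.toEnd K L ((L ⊗[K] L) ⊗[K] L) u ∘ₗ cycSum K L := by
    apply TensorProduct.ext_threefold
    intro a b c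
    simp [cycSum_apply, TensorProduct.LieModule.lie_tmul_right, TensorProduct.add_tmul]
    abel
  exact LinearMap.congr_fun h x

/-- The map `x ⊗ y ↦ [x, t] ⊗ y`. -/
noncomputable def lieLeft (t : L ⊗[K] L) : L ⊗[K] L →ₗ[K] (L ⊗[K] L) ⊗[K] L :=
  TensorProduct.map ((LieModule.toEnd K L (L ⊗[K] L)).toLinearMap.flip t) LinearMap.id

@[simp] theorem lieLeft_tmul (t : L ⊗[K] L) (x y : L) :
    lieLeft t (x ⊗ₜ[K] y) = ⁅x, t⁆ ⊗ₜ[K] y := rfl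

theorem lieLeft_add (t t' s : L ⊗[K] L) : lieLeft (t + t') s = lieLeft t s + lieLeft t' s := by
  simp [lieLeft, TensorProduct.map_add_left]

/-- The defect from equivariance of `δ ⊗ id` comes from the term `[x, δ u]` in `δ [u, x]`. -/
theorem map_cocycle_lie {δ : L →ₗ[K] L ⊗[K] L}
    (hδ : ∀ u v, δ ⁅u, v⁆ = ⁅u, δ v⁆ - ⁅v, δ u⁆) (u : L) (s : L ⊗[K] L) :
    TensorProduct.map δ LinearMap.id ⁅u, s⁆ =
      ⁅u, TensorProduct.map δ LinearMap.id s⁆ - lieLeft (δ u) s := by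
  induction s using TensorProduct.induction_on with
  | zero => simp
  | add a b ha hb => simp only [lie_add, map_add, ha, hb]; abel
  | tmul x y =>
    simp [TensorProduct.LieModule.lie_tmul_right, hδ, TensorProduct.sub_tmul]
    abel

/-- The map `(x ⊗ y) ⊗ (p ⊗ q) ↦ [x, p] ⊗ q ⊗ y`. -/
noncomputable def lieInner (K : Type u) [Field K] (L : Type u) [LieRing L] [LieAlgebra K L] :
    (L ⊗[K] L) ⊗[K] (L ⊗[K] L) →ₗ[K] (L ⊗[K] L) ⊗[K] L :=
  (TensorProduct.assoc K L L L).symm.toLinearMap ∘ₗ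
    TensorProduct.map (LieModule.toModuleHom K L L).toLinearMap
      (TensorProduct.comm K L L).toLinearMap ∘ₗ
    (TensorProduct.tensorTensorTensorComm K L L L L).toLinearMap

@[simp] theorem lieInner_tmul (x y p q : L) :
    lieInner K L ((x ⊗ₜ y) ⊗ₜ (p ⊗ₜ q)) = (⁅x, p⁆ ⊗ₜ[K] q) ⊗ₜ[K] y := by
  simp [lieInner]

/-- For `s = x ⊗ y` and `t = p ⊗ q`, the term `p ⊗ [x, q] ⊗ y` is cyclically equivalent to `-[q, x]
⊗ y ⊗ p`. For skew `s` and `t` the right side becomes symmetric in them. -/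
theorem cycSum_lieLeft (s t : L ⊗[K] L) : cycSum K L (lieLeft t s) =
    cycSum K L (lieInner K L (s ⊗ₜ t)) -
      cycSum K L (lieInner K L (TensorProduct.comm K L L t ⊗ₜ s)) := by
  induction s using TensorProduct.induction_on with
  | zero => simp
  | add a b ha hb =>
    simp only [map_add, ha, hb, TensorProduct.add_tmul, TensorProduct.tmul_add]; abel
  | tmul x y =>
    induction t using TensorProduct.induction_on with
    | zero => simp
    | add a b ha hb =>
      rw [lieLeft_add]
      simp only [map_add, ha, hb, TensorProduct.add_tmul, TensorProduct.tmul_add]; abel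
    | tmul p q =>
      rw [lieLeft_tmul, TensorProduct.LieModule.lie_tmul_right, TensorProduct.comm_tmul,
        lieInner_tmul, lieInner_tmul, ← lie_skew q x]
      simp [-lie_skew, cycSum_apply, TensorProduct.add_tmul, TensorProduct.neg_tmul]
      abel

theorem cycSum_lieLeft_symm {s t : L ⊗[K] L} (hs : TensorProduct.comm K L L s = -s)
    (ht : TensorProduct.comm K L L t = -t) :
    cycSum K L (lieLeft t s) = cycSum K L (lieLeft s t) := by
  rw [cycSum_lieLeft, cycSum_lieLeft, hs, ht]
  simp only [TensorProduct.neg_tmul, map_neg]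
  abel

theorem coJacobiator_lie {δ : ℕ → L →ₗ[K] L ⊗[K] L}
    (hδ : ∀ n u v, δ n ⁅u, v⁆ = ⁅u, δ n v⁆ - ⁅v, δ n u⁆)
    (hskew : ∀ n v, TensorProduct.comm K L L (δ n v) = -δ n v) (n : ℕ) (u v : L) :
    coJacobiator δ n ⁅u, v⁆ = ⁅u, coJacobiator δ n v⁆ - ⁅v, coJacobiator δ n u⁆ := by
  -- These are the two families of defect terms; they cancel after exchanging the indices of the
  -- antidiagonal.
  have h : ∑ p ∈ Finset.HasAntidiagonal.antidiagonal n, cycSum K L (lieLeft (δ p.2 u) (δ p.1 v)) =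
      ∑ p ∈ Finset.HasAntidiagonal.antidiagonal n, cycSum K L (lieLeft (δ p.2 v) (δ p.1 u)) := by
    rw [← Finset.Nat.sum_antidiagonal_swap]
    exact Finset.sum_congr rfl fun p _ => cycSum_lieLeft_symm (hskew _ _) (hskew _ _)
  simp only [coJacobiator_apply, lie_sum]
  rw [← sub_eq_zero] at h ⊢
  rw [← neg_eq_zero, ← h]
  simp only [← Finset.sum_sub_distrib, ← Finset.sum_neg_distrib]
  refine Finset.sum_congr rfl fun p _ => ?_
  rw [hδ, map_sub, map_cocycle_lie (hδ p.2), map_cocycle_lie (hδ p.2)]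
  simp only [map_sub, cycSum_lie]
  abel

end CoJacobi

/-! ### The Lie bialgebra of series over a `K`-Lie algebra -/

section OfLie

variable {K : Type u} [Field K] {L : Type u} [LieRing L] [LieAlgebra K L]

/-- This turns the cocycle axiom over `K[[ħ]]` into ordinary cocycle identities for the Lie module
`L ⊗ L`, one for each `δ n`. -/
theorem leibniz_bilin_lie (x : Ser L) :
    leibniz (bilin (LieModule.toEnd K L L).toLinearMap x) =
      bilin (LieModule.toEnd K L (L ⊗[K] L)).toLinearMap x := by
  refine linearMap_ext fun w => ?_
  induction w using TensorProduct.induction_on with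
  | zero => simp
  | add a b ha hb => simp only [const_add, map_add, ha, hb]
  | tmul v w =>
    ext n
    rw [const_tmul, leibniz_tmul, ← const_tmul]
    simp [tmul, TensorProduct.LieModule.lie_tmul_right]

theorem bilin_lie_const (u v : L) :
    bilin (LieModule.toEnd K L L).toLinearMap (const u) (const v) = const ⁅u, v⁆ := by
  ext n
  rw [bilin_const_left]
  by_cases h : n = 0 <;> simp [const_coeff, h]

theorem extend_bilin_lie {δ : ℕ → L →ₗ[K] L ⊗[K] L}
    (hδ : ∀ n u v, δ n ⁅u, v⁆ = ⁅u, δ n v⁆ - ⁅v, δ n u⁆) (x y : Ser L) :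
    extend δ (bilin (LieModule.toEnd K L L).toLinearMap x y) =
      leibniz (bilin (LieModule.toEnd K L L).toLinearMap x) (extend δ y) -
        leibniz (bilin (LieModule.toEnd K L L).toLinearMap y) (extend δ x) := by
  simp only [leibniz_bilin_lie]
  set B₂ := bilin (LieModule.toEnd K L (L ⊗[K] L)).toLinearMap
  have h : (bilin (LieModule.toEnd K L L).toLinearMap).compr₂ (extend δ) =
      B₂.compl₂ (extend δ) - (B₂.compl₂ (extend δ)).flip := by
    refine bilin_ext fun u v => Ser.ext (funext fun n => ?_)
    simp only [LinearMap.compr₂_apply, LinearMap.sub_apply, LinearMap.compl₂_apply,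
      LinearMap.flip_apply, bilin_lie_const, B₂, coeff_sub, bilin_const_left, extend_const, hδ]
    rfl
  exact LinearMap.congr_fun₂ h x y

/-- The Lie bialgebra `L[[ħ]]`, for a Lie algebra `L` over `K` and a cobracket `∑ δₙ ħⁿ`. -/
noncomputable def LBA.ofLie [CharZero K] (δ : ℕ → L →ₗ[K] L ⊗[K] L)
    (hδ : ∀ n u v, δ n ⁅u, v⁆ = ⁅u, δ n v⁆ - ⁅v, δ n u⁆)
    (hskew : ∀ n v, TensorProduct.comm K L L (δ n v) = -δ n v)
    (hjac : ∀ n v, coJacobiator δ n v = 0) : LBA K where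
  V := L
  bracket := bilin (LieModule.toEnd K L L).toLinearMap
  cobracket := extend δ
  bracket_self x := by
    ext n
    -- Exchanging the indices shows the coefficient equals its own negative; it vanishes because `2
    -- ≠ 0`.
    have h : (bilin (LieModule.toEnd K L L).toLinearMap x x).coeff n =
        -(bilin (LieModule.toEnd K L L).toLinearMap x x).coeff n := by
      conv_lhs => rw [bilin_coeff, ← Finset.Nat.sum_antidiagonal_swap]
      rw [bilin_coeff, ← Finset.sum_neg_distrib]
      exact Finset.sum_congr rfl fun p _ => (lie_skew _ _).symm
    rw [eq_neg_iff_add_eq_zero, ← two_smul K] at h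
    exact (smul_eq_zero_iff_right two_ne_zero).1 h
  jacobi x y z := by
    set B := bilin (LieModule.toEnd K L L).toLinearMap
    have hB : ∀ u v : L, B (const u) (const v) = const ⁅u, v⁆ := bilin_lie_const
    -- The Jacobi identity holds on constants; `h₁`, `h₂`, `h₃` free one argument at a time.
    have h₁ : ∀ u v, B.flip (B (const u) (const v)) + B (const u) ∘ₗ B (const v)
        + B (const v) ∘ₗ B.flip (const u) = 0 := fun u v => linearMap_ext fun w => by
      simp only [LinearMap.add_apply, LinearMap.flip_apply, LinearMap.comp_apply, hB,
        LinearMap.zero_apply, ← const_add]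
      rw [lie_jacobi w u v, const_zero]
    have h₂ : ∀ u z, B (const u) ∘ₗ B.flip z + B.flip (B z (const u)) + B z ∘ₗ B (const u) = 0 :=
      fun u z => linearMap_ext fun w => by
        have := LinearMap.congr_fun (h₁ u w) z
        simp only [LinearMap.add_apply, LinearMap.flip_apply, LinearMap.comp_apply,
          LinearMap.zero_apply] at this ⊢
        rw [← this]
        abel
    have h₃ : B.flip (B y z) + B y ∘ₗ B z + B z ∘ₗ B.flip y = 0 := linearMap_ext fun w => by
      have := LinearMap.congr_fun (h₂ w z) y
      simpa only [LinearMap.add_apply, LinearMap.flip_apply, LinearMap.comp_apply,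
        LinearMap.zero_apply] using this
    exact LinearMap.congr_fun h₃ x
  cobracket_skew x := by
    ext n
    simp only [congr_coeff, coeff_neg, extend_coeff, map_sum, hskew, Finset.sum_neg_distrib]
  cojacobi x := by
    have h : tens (extend δ) LinearMap.id ∘ₗ extend δ
        + (Ser.congr (cyc K L)).toLinearMap ∘ₗ tens (extend δ) LinearMap.id ∘ₗ extend δ
        + (Ser.congr (cyc K L)).toLinearMap ∘ₗ (Ser.congr (cyc K L)).toLinearMap ∘ₗ
          tens (extend δ) LinearMap.id ∘ₗ extend δ = 0 := by
      refine linearMap_ext fun v => Ser.ext (funext fun n => ?_)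
      refine (cojacobi_const (extend δ) v n).trans ?_
      rw [show coeffHom (extend δ) = δ from funext (coeffHom_extend δ), hjac]
      rfl
    exact LinearMap.congr_fun h x
  cocycle x y := extend_bilin_lie hδ x y

end OfLie

theorem LBA.bracket_skew {K : Type u} [Field K] (A : LBA K) (x y : Ser A.V) :
    A.bracket x y = -A.bracket y x := by
  have h := A.bracket_self (x + y)
  simp only [map_add, LinearMap.add_apply, A.bracket_self, zero_add, add_zero] at h
  exact eq_neg_of_add_eq_zero_right h

/-! ### Restriction of scalars to `K`, giving targets for maps from free Lie algebras -/

section Carrier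

variable {K : Type u} [Field K] (A : LBA K)

/-- The underlying Lie algebra over `K` of a Lie bialgebra over `K[[ħ]]`. -/
@[ext] structure LBA.Carrier : Type u where
  /-- the underlying series -/
  ser : Ser A.V

namespace LBA.Carrier

/-- The underlying module is that of the Lie bialgebra. -/
def equivSer : A.Carrier ≃ Ser A.V where
  toFun a := a.ser
  invFun x := ⟨x⟩

instance : AddCommGroup A.Carrier := (equivSer A).addCommGroup
noncomputable instance : SMul K A.Carrier := ⟨fun c x => ⟨PowerSeries.C c • x.ser⟩⟩
noncomputable instance : Bracket A.Carrier A.Carrier := ⟨fun x y => ⟨A.bracket x.ser y.ser⟩⟩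

variable {A} (x y : A.Carrier) (c : K)

@[simp] theorem ser_add : (x + y).ser = x.ser + y.ser := rfl
@[simp] theorem ser_zero : (0 : A.Carrier).ser = 0 := rfl
@[simp] theorem ser_smul : (c • x).ser = PowerSeries.C c • x.ser := rfl
@[simp] theorem ser_lie : ⁅x, y⁆.ser = A.bracket x.ser y.ser := rfl

noncomputable instance : Module K A.Carrier where
  one_smul x := LBA.Carrier.ext (by rw [ser_smul, map_one, one_smul])
  mul_smul c d x := LBA.Carrier.ext (by simp only [ser_smul, map_mul, mul_smul])
  smul_zero c := LBA.Carrier.ext (by simp only [ser_smul, ser_zero, smul_zero])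
  smul_add c x y := LBA.Carrier.ext (by simp only [ser_smul, ser_add, smul_add])
  add_smul c d x := LBA.Carrier.ext (by simp only [ser_smul, ser_add, map_add, add_smul])
  zero_smul x := LBA.Carrier.ext (by simp only [ser_smul, ser_zero, map_zero, zero_smul])

noncomputable instance : LieRing A.Carrier where
  add_lie x y z := LBA.Carrier.ext (by simp)
  lie_add x y z := LBA.Carrier.ext (by simp)
  lie_self x := LBA.Carrier.ext (A.bracket_self _)
  leibniz_lie x y z := LBA.Carrier.ext (by
    have h := A.jacobi x.ser y.ser z.ser
    rw [A.bracket_skew z.ser x.ser, A.bracket_skew z.ser (A.bracket _ _), map_neg] at h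
    simp only [ser_lie, ser_add]
    rw [← sub_eq_zero, ← h]
    abel)

noncomputable instance : LieAlgebra K A.Carrier where
  lie_smul c x y := LBA.Carrier.ext (by simp)

end LBA.Carrier

end Carrier

/-- The underlying `K`-linear family of a Lie algebra homomorphism from `L` to `A` extends to
`L[[ħ]]`. -/
theorem exists_extend_lieHom {K : Type u} [Field K] {L : Type u} [LieRing L] [LieAlgebra K L]
    (A : LBA K) (P : L →ₗ⁅K⁆ A.Carrier) :
    ∃ π : Ser L →ₗ[PowerSeries K] Ser A.V, (∀ v, π (const v) = (P v).ser) ∧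
      ∀ x y, π (bilin (LieModule.toEnd K L L).toLinearMap x y) = A.bracket (π x) (π y) := by
  let π : Ser L →ₗ[PowerSeries K] Ser A.V := extend fun n =>
    { toFun := fun v => (P v).ser.coeff n
      map_add' := fun v w => by simp
      map_smul' := fun c v => by simp }
  have hπ : ∀ v, π (const v) = (P v).ser := fun v => Ser.ext (funext fun n => extend_const _ v n)
  refine ⟨π, hπ, fun x y => ?_⟩
  have h : (bilin (LieModule.toEnd K L L).toLinearMap).compr₂ π = A.bracket.compl₁₂ π π := by
    refine bilin_ext fun u v => ?_
    simp [bilin_lie_const, hπ]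
  exact LinearMap.congr_fun₂ h x y

/-! ### The free cover of a Lie bialgebra -/

theorem lie_comm {K : Type u} [Field K] {L : Type u} [LieRing L] [LieAlgebra K L] (u : L)
    (x : L ⊗[K] L) : TensorProduct.comm K L L ⁅u, x⁆ = ⁅u, TensorProduct.comm K L L x⁆ := by
  induction x using TensorProduct.induction_on with
  | zero => simp
  | add a b ha hb => simp [ha, hb]
  | tmul x y => simp [TensorProduct.LieModule.lie_tmul_right, add_comm]

theorem comm_map {K : Type u} [Field K] {V W : Type u} [AddCommGroup V] [Module K V]
    [AddCommGroup W] [Module K W] (j : V →ₗ[K] W) (x : V ⊗[K] V) :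
    TensorProduct.comm K W W (TensorProduct.map j j x) =
      TensorProduct.map j j (TensorProduct.comm K V V x) := by
  induction x using TensorProduct.induction_on with
  | zero => simp
  | add a b ha hb => simp [ha, hb]
  | tmul x y => simp

/-- A cobracket on a vector space with a basis indexed by `I` extends to the free Lie algebra on
`I` and one more generator with cobracket zero. -/
theorem exists_freeLie_cobracket {K : Type u} [Field K] {V I : Type u} [AddCommGroup V]
    [Module K V] (b : Module.Basis I K V) (δV : ℕ → V →ₗ[K] V ⊗[K] V)
    (hskewV : ∀ n v, TensorProduct.comm K V V (δV n v) = -δV n v)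
    (hjacV : ∀ n v, coJacobiator δV n v = 0) (j : V →ₗ[K] FreeLieAlgebra K (Option I))
    (hj : ∀ i, j (b i) = FreeLieAlgebra.of K (some i)) :
    ∃ δ : ℕ → FreeLieAlgebra K (Option I) →ₗ[K]
        FreeLieAlgebra K (Option I) ⊗[K] FreeLieAlgebra K (Option I),
      (∀ n u v, δ n ⁅u, v⁆ = ⁅u, δ n v⁆ - ⁅v, δ n u⁆) ∧
      (∀ n v, TensorProduct.comm K _ _ (δ n v) = -δ n v) ∧ (∀ n v, coJacobiator δ n v = 0) ∧
      (∀ n v, δ n (j v) = TensorProduct.map j j (δV n v)) ∧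
      ∀ n, δ n (FreeLieAlgebra.of K none) = 0 := by
  choose δ hδ' hδof using fun n => FreeLie.exists_cocycle
    (LieModule.toEnd K (FreeLieAlgebra K (Option I))
      (FreeLieAlgebra K (Option I) ⊗[K] FreeLieAlgebra K (Option I)))
    fun o : Option I => o.elim 0 fun i => TensorProduct.map j j (δV n (b i))
  have hδ : ∀ n u v, δ n ⁅u, v⁆ = ⁅u, δ n v⁆ - ⁅v, δ n u⁆ := hδ'
  have hδj : ∀ n v, δ n (j v) = TensorProduct.map j j (δV n v) := by
    intro n v
    have h : δ n ∘ₗ j = TensorProduct.map j j ∘ₗ δV n := b.ext fun i => by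
      simp only [LinearMap.comp_apply, hj, hδof, Option.elim]
    exact LinearMap.congr_fun h v
  have hskew : ∀ n v, TensorProduct.comm K _ _ (δ n v) = -δ n v := by
    intro n v
    rw [eq_neg_iff_add_eq_zero]
    -- The symmetrization of `δ n` is a cocycle, so its vanishing is tested on generators.
    refine FreeLie.cocycle_eq_zero (LieModule.toEnd K _ _)
      (D := (TensorProduct.comm K _ _).toLinearMap ∘ₗ δ n + δ n) (fun u v => ?_) (fun o => ?_) v
    · simp [hδ, lie_comm]
      abel
    · rcases o with _ | i
      · simp [hδof]
      · simp [hδof, comm_map, hskewV]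
  refine ⟨δ, hδ, hskew, fun n v => ?_, hδj, fun n => hδof n none⟩
  refine FreeLie.cocycle_eq_zero (LieModule.toEnd K _ _)
    (fun u v => coJacobiator_lie hδ hskew n u v) (fun o => ?_) v
  rcases o with _ | i
  · simp [coJacobiator_apply, hδof]
  · have hmap : ∀ (k : ℕ) (x : V ⊗[K] V),
        TensorProduct.map (δ k) LinearMap.id (TensorProduct.map j j x) =
          TensorProduct.map (TensorProduct.map j j) j
            (TensorProduct.map (δV k) LinearMap.id x) := by
      intro k x
      induction x using TensorProduct.induction_on with
      | zero => simp
      | add a b ha hb => simp only [map_add, ha, hb]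
      | tmul x y => simp [hδj]
    rw [← hj, coJacobiator_apply]
    simp only [hδj, hmap, cycSum_map]
    rw [← map_sum, ← coJacobiator_apply, hjacV, map_zero]

/-- A homomorphism from a free Lie algebra is compatible with the cobrackets if it is so on the
generators. -/
theorem cobracket_eq_of_generators {K : Type u} [Field K] {X : Type u} (A : LBA K)
    {δ : ℕ → FreeLieAlgebra K X →ₗ[K] FreeLieAlgebra K X ⊗[K] FreeLieAlgebra K X}
    (hδ : ∀ n u v, δ n ⁅u, v⁆ = ⁅u, δ n v⁆ - ⁅v, δ n u⁆)
    (π : Ser (FreeLieAlgebra K X) →ₗ[PowerSeries K] Ser A.V)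
    (hπ : ∀ x y, π (bilin (LieModule.toEnd K _ (FreeLieAlgebra K X)).toLinearMap x y) =
      A.bracket (π x) (π y))
    (h : ∀ x, A.cobracket (π (const (FreeLieAlgebra.of K x))) =
      tens π π (extend δ (const (FreeLieAlgebra.of K x)))) (x : Ser (FreeLieAlgebra K X)) :
    A.cobracket (π x) = tens π π (extend δ x) := by
  -- Both sides obey the same cocycle rule along `π`, so the elements where they agree form a
  -- subalgebra.
  let S : LieSubalgebra K (FreeLieAlgebra K X) :=
    { carrier := {v | A.cobracket (π (const v)) = tens π π (extend δ (const v))}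
      add_mem' := fun {u v} hu hv => by
        simp only [Set.mem_ofPred_eq, const_add, map_add] at hu hv ⊢
        rw [hu, hv]
      zero_mem' := by
        simp only [Set.mem_ofPred_eq, const_zero, map_zero]
      smul_mem' := fun c v hv => by
        simp only [Set.mem_ofPred_eq, const_smul, map_smul] at hv ⊢
        rw [hv]
      lie_mem' := fun {u v} hu hv => by
        change _ = _ at hu hv
        change _ = _
        have ht : ∀ (w : FreeLieAlgebra K X) x, tens π π (leibniz (bilin (LieModule.toEnd K (FreeLieAlgebra K X)
            (FreeLieAlgebra K X)).toLinearMap (const w)) x) =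
            leibniz (A.bracket (π (const w))) (tens π π x) := fun w x =>
          tens_leibniz (LinearMap.ext fun y => hπ (const w) y) x
        rw [← bilin_lie_const (K := K), hπ, A.cocycle, extend_bilin_lie hδ, map_sub, hu, hv, ht, ht] }
  have hS : A.cobracket ∘ₗ π = tens π π ∘ₗ extend δ := linearMap_ext fun v => by
    have : v ∈ S := by
      rw [FreeLie.lieSubalgebra_eq_top S h]
      trivial
    exact this
  exact LinearMap.congr_fun hS x

/-- Every Lie bialgebra is the image of a Lie bialgebra with an element whose cobracket vanishes,
and whose centralizer is mapped to zero. -/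
theorem exists_cover {K : Type u} [Field K] [CharZero K] (A : LBA K) :
    ∃ (F : LBA K) (π : Ser F.V →ₗ[PowerSeries K] Ser A.V) (d : F.V) (j : A.V → F.V),
      IsMorphism F A π ∧ F.cobracket (const d) = 0 ∧
      (∀ z, F.bracket (const d) z = 0 → π z = 0) ∧ ∀ v, π (const (j v)) = const v := by
  let b := Module.Basis.ofVectorSpace K A.V
  let j := b.constr K fun i =>
    FreeLieAlgebra.of K (some i : Option (Module.Basis.ofVectorSpaceIndex K A.V))
  have hj : ∀ i, j (b i) = FreeLieAlgebra.of K (some i) := fun i => b.constr_basis K _ i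
  obtain ⟨δ, hδ, hskew, hjac, hδj, hδd⟩ := exists_freeLie_cobracket b (coeffHom A.cobracket)
    (fun n v => congrArg (fun x => Ser.coeff x n) (A.cobracket_skew (const v)))
    (fun n v => (cojacobi_const A.cobracket v n).symm.trans
      (congrArg (fun x => Ser.coeff x n) (A.cojacobi (const v)))) j hj
  have hd : extend δ (const (FreeLieAlgebra.of K none)) = 0 := by
    ext n
    rw [extend_const, hδd, coeff_zero]
  -- Basis generators go to the constant basis vectors, and below the extra generator goes to `0`.
  let g : Module.Basis.ofVectorSpaceIndex K A.V → A.Carrier := fun i => ⟨const (b i)⟩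
  obtain ⟨π, hπ, hlie⟩ := exists_extend_lieHom A
    (FreeLieAlgebra.lift K fun o : Option (Module.Basis.ofVectorSpaceIndex K A.V) => o.elim 0 g)
  have hπj : π ∘ₗ map j = LinearMap.id := linearMap_ext fun v => by
    ext n
    have h : coeffHom π n ∘ₗ j = coeffHom (LinearMap.id : Ser A.V →ₗ[PowerSeries K] Ser A.V) n :=
      b.ext fun i => by simp [hj, coeffHom_apply, hπ, g]
    simpa [coeffHom_apply] using LinearMap.congr_fun h v
  have hπjc : ∀ v, π (const (j v)) = const v := fun v => by
    simpa using LinearMap.congr_fun hπj (const v)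
  have hcob := cobracket_eq_of_generators A hδ π hlie fun o => by
    rcases o with _ | i
    · rw [hd, hπ, FreeLieAlgebra.lift_of_apply, map_zero]
      exact map_zero _
    · have h1 : extend δ (const (j (b i))) =
          map (TensorProduct.map j j) (A.cobracket (const (b i))) := by
        ext n
        rw [extend_const]
        exact hδj n (b i)
      -- On a basis generator the cobracket is `(j ⊗ j)` of that of `A`, and `π ∘ j = id` undoes it.
      rw [← hj, h1, ← tens_map, ← LinearMap.comp_apply (tens π π), ← tens_comp, hπj, tens_id, hπjc]
      rfl
  -- The bracket of the cover does not involve `ħ`, so each coefficient of `z` commutes with `d`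
  -- separately, and the centralizer lemma over `K` applies to it.
  have hcent : ∀ z, bilin (LieModule.toEnd K _ _).toLinearMap
      (const (FreeLieAlgebra.of K (none : Option (Module.Basis.ofVectorSpaceIndex K A.V)))) z = 0 →
      π z = 0 := by
    intro z hz
    have h : π = extend (coeffHom π) := linearMap_ext fun v => by ext n; simp [coeffHom_apply]
    ext n
    rw [h, extend_coeff, coeff_zero]
    refine Finset.sum_eq_zero fun p _ => ?_
    rw [coeffHom_apply, hπ, FreeLie.lift_eq_zero_of_lie_eq_zero g (z.coeff p.1)]
    · rfl
    · have h := congrArg (fun x => Ser.coeff x p.1) hz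
      exact (bilin_const_left _ _ z p.1).symm.trans h
  exact ⟨LBA.ofLie δ hδ hskew hjac, π, FreeLieAlgebra.of K none, j, ⟨hlie, hcob⟩, hd, hcent, hπjc⟩

/-! ### The rank-one Lie bialgebra and the scalar by which `ρ` acts -/

/-- The Lie bialgebra of rank one. -/
noncomputable def LBA.unit (K : Type u) [Field K] : LBA K where
  V := K
  bracket := 0
  cobracket := 0
  bracket_self := by simp
  jacobi := by simp
  cobracket_skew := by simp
  cojacobi x := by
    simp only [LinearMap.zero_apply, map_zero]
    exact (add_zero (0 + 0 : Ser ((K ⊗[K] K) ⊗[K] K))).trans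
      (add_zero (0 : Ser ((K ⊗[K] K) ⊗[K] K)))
  cocycle := by simp

theorem mk_smul_const_one {K : Type u} [Field K] (x : Ser K) :
    PowerSeries.mk x.coeff • const (1 : K) = x := by
  ext n
  rw [coeff_smul]
  refine (sum_antidiagonal_const' (1 : K) n
    (fun j v => PowerSeries.coeff j (PowerSeries.mk x.coeff) • v) (by simp)).trans ?_
  simp

theorem smul_const_one_injective {K : Type u} [Field K] {c d : PowerSeries K}
    (h : c • const (1 : K) = d • const (1 : K)) : c = d := by
  have hc : ∀ (e : PowerSeries K) (n : ℕ), (e • const (1 : K)).coeff n = PowerSeries.coeff n e := by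
    intro e n
    rw [coeff_smul]
    refine (sum_antidiagonal_const' (1 : K) n
      (fun j v => PowerSeries.coeff j e • v) (by simp)).trans ?_
    simp
  ext n
  rw [← hc, h, hc]

/-- The rank-one Lie bialgebra already detects the scalar. -/
theorem scalar_injective (K : Type u) [Field K] : Function.Injective (scalar K) := by
  intro c d h
  have h1 := LinearMap.congr_fun (congrFun h (LBA.unit K)) (const (1 : K))
  exact Subtype.ext (Units.ext (smul_const_one_injective h1))

theorem scalar_mem_G0 (K : Type u) [Field K] (c : oneAddHbar K) : scalar K c ∈ G0 K := by
  obtain ⟨c, e, he⟩ := c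
  refine ⟨fun A B f _ x => ?_, fun A x => ⟨e • x, ?_⟩, fun A B p _ x ξ => ?_, fun A x y => ?_, ?_⟩
  · simp [scalar]
  · simp [scalar, he, add_smul, mul_smul]
  · simp [scalar]
  · simp [scalar]
  -- Universality: a scalar assignment is a multiple of the identity permutation of one factor.
  · have h := IsUniversal.smul (c : PowerSeries K) (IsUniversal.perm (K := K) 1 (Equiv.refl _))
    convert h using 1
    funext A
    ext x n
    simp only [PiTensorProduct.reindex_refl]
    simp [scalar]
    rfl

/-- An element with vanishing bracket and cobracket spans the image of a morphism from the Lie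
bialgebra of rank one. -/
theorem isMorphism_unit {K : Type u} [Field K] (B : LBA K) (d : B.V)
    (hd : B.cobracket (const d) = 0) :
    IsMorphism (LBA.unit K) B (map (LinearMap.toSpanSingleton K B.V d)) := by
  have hconst : ∀ a : K, map (LinearMap.toSpanSingleton K B.V d) (const a) =
      PowerSeries.C a • const d := fun a => by
    rw [Ser.map_const, LinearMap.toSpanSingleton_apply, const_smul]
  constructor
  · have h : (0 : Ser K →ₗ[PowerSeries K] Ser K →ₗ[PowerSeries K] Ser B.V) =
        B.bracket.compl₁₂ (map (LinearMap.toSpanSingleton K B.V d))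
          (map (LinearMap.toSpanSingleton K B.V d)) := bilin_ext fun a c => by
      simp only [LinearMap.zero_apply, LinearMap.compl₁₂_apply, hconst, map_smul,
        LinearMap.smul_apply, B.bracket_self, smul_zero]
    exact fun x y => (map_zero _).trans (LinearMap.congr_fun₂ h x y)
  · have h : B.cobracket ∘ₗ map (LinearMap.toSpanSingleton K B.V d) = 0 :=
      linearMap_ext fun a => by
        simp only [LinearMap.zero_apply, LinearMap.comp_apply, hconst, map_smul, hd, smul_zero]
    exact fun x => (LinearMap.congr_fun h x).trans (map_zero _).symm

/-- An endomorphism in `𝒢₀(K)` acts on every Lie bialgebra by the same scalar as on the Lie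
bialgebra of rank one. -/
theorem IsG0.eq_smul {K : Type u} [Field K] [CharZero K] {ρ : EndAssignment K} (h : IsG0 ρ)
    {c : PowerSeries K} (hc : ρ (LBA.unit K) (const (1 : K)) = c • const (1 : K)) (A : LBA K) :
    ρ A = c • LinearMap.id := by
  obtain ⟨F, π, d, j, hπ, hd, hcent, hj⟩ := exists_cover A
  -- Functoriality along `1 ↦ d` transports the scalar `c` to `d`.
  have hρd : ρ F (const d) = c • const d := by
    have hf := h.functorial _ _ _ (isMorphism_unit F d hd) (const (1 : K))
    have h1 : map (LinearMap.toSpanSingleton K F.V d) (const (1 : K)) = const d := by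
      rw [Ser.map_const, LinearMap.toSpanSingleton_apply, one_smul]
    rw [hc] at hf
    exact (h1 ▸ hf.symm).trans ((map_smul _ c _).trans (congrArg (c • ·) h1))
  refine linearMap_ext fun v => ?_
  have hz : π (ρ F (const (j v)) - c • const (j v)) = 0 := by
    refine hcent _ ?_
    -- Skew-symmetry moves `ρ` from the second argument to the first: `[d, ρ z] = ρ [d, z] = [ρ d,
    -- z] = c [d, z]`.
    rw [map_sub, map_smul, F.bracket_skew, h.bracket, F.bracket_skew, map_neg, neg_neg,
      ← h.bracket, hρd, map_smul, LinearMap.smul_apply, sub_self]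
  rw [map_sub, map_smul, sub_eq_zero, h.functorial _ _ _ hπ, hj] at hz
  rw [hz, LinearMap.smul_apply, LinearMap.id_apply]

end LieBialg

theorem theorem1p1 (K : Type u) [Field K] [CharZero K] :
    Function.Injective (LieBialg.scalar K) ∧
      LieBialg.G0 K = Set.range (LieBialg.scalar K) := by
  refine ⟨LieBialg.scalar_injective K, Set.Subset.antisymm (fun ρ hρ => ?_) ?_⟩
  · have h : LieBialg.IsG0 ρ := hρ
    obtain ⟨y, hy⟩ := h.mod_hbar (LieBialg.LBA.unit K) (LieBialg.Ser.const (1 : K))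
    have hy' : ρ (LieBialg.LBA.unit K) (LieBialg.Ser.const (1 : K)) =
        (1 + PowerSeries.X * PowerSeries.mk (R := K) y.coeff : PowerSeries K) •
          LieBialg.Ser.const (1 : K) := by
      rw [add_smul, one_smul, mul_smul]
      exact hy.trans (congrArg (fun z => _ + (PowerSeries.X : PowerSeries K) • z)
        (LieBialg.mk_smul_const_one (K := K) y).symm)
    -- The constant coefficient is `1`, so this scalar is a unit and lies in the subgroup `1 +
    -- ħK[[ħ]]`.
    have hu : IsUnit (1 + PowerSeries.X * PowerSeries.mk (R := K) y.coeff : PowerSeries K) := by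
      rw [PowerSeries.isUnit_iff_constantCoeff]
      simp
    exact ⟨⟨hu.unit, PowerSeries.mk (R := K) y.coeff, rfl⟩, funext fun A => (h.eq_smul hy' A).symm⟩
  · rintro _ ⟨c, rfl⟩
    exact LieBialg.scalar_mem_G0 K c
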